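/- Let $\Delta=\{z\in\mathbb C:|z|<1\}$. A one-parameter continuous semigroup on $\Delta$ is a family $\{F_t\}_{t\ge 0}$ of holomorphic self-maps of $\Delta$ with $F_0=\mathrm{id}$, $F_{t+s}=F_t\circ F_s$, and $t\mapsto F_t(z)$ continuous on $[0,\infty)$ for each $z\in\Delta$. A holomorphic $f:\Delta\to\mathbb C$ is a generator if, for some such semigroup, $f(z)=\lim_{t\to0^+}(z-F_t(z))/t$ for all $z\in\Delta$. Write $\angle\lim_{z\to\zeta}$ for the angular (non-tangential) limit at a point $\zeta\in\partial\Delta$. A univalent (holomorphic and injective) function $h$ on $\Delta$ is *spirallike* if there is $\nu\in\mathbb C$ with $\operatorname{Re}\nu>0$ such that $e^{-t\nu}h(z)\in h(\Delta)$ for all $z\in\Delta$, $t\ge0$; it is *starlike* if $t\,h(z)\in h(\Delta)$ for all $z\in\Delta$, $t\in(0,1]$. For $\tau\in\Delta$, $\mathrm{Spi}[\tau]$ is the set of spirallike $h$ with $h(\tau)=0$. For $\tau\in\partial\Delta$, $\mathrm{Spi}[\tau]$ (respectively $S^*[\tau]$) is the set of spirallike (respectively starlike) $h$ with $0\in\partial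 h(\Delta)$ and $\angle\lim_{z\to\tau}h(z)=0$. **Theorem (Perturbation formula).** Let $f$ be a generator with $\angle\lim_{z\to1}f(z)=0$ and $\angle\lim_{z\to1}\frac{f(z)}{z-1}=\beta$, where $\beta>0$ is real. Let $\Omega_+=\{w\in\mathbb C: w\ne0,\ |w-\beta|\le\beta\}$ and $\lambda\in\Omega_+$. Let $h$ be holomorphic on $\Delta$ with $$\lambda h(z)=h'(z)f(z)\quad(z\in\Delta),\qquad h(0)=1,\qquad \angle\lim_{z\to1}h(z)=0 .$$ Then $h$ has a holomorphic logarithm $\log h$ on $\Delta$ with $\log h(0)=0$; put $h^{a}=e^{a\log h}$ for $a\in\mathbb C$. For every $\mu\in\Omega_+$ and $\tau\in\Delta$, the function $$h_\tau(z)=h(z)^{\mu/\lambda}\,\frac{(z-\tau)(1-z\bar\tau)^{\mu/\bar\mu}}{-(1-z)^{1+\mu/\bar\mu}}$$ (with principal powers of $1-z\bar\tau$ and $1-z$) is univalent on $\Delta$, belongs to $\mathrm{Spi}[\tau]$, and satisfies $h_\tau(\tau)=0$ and $h_\tau(0)=\tau$. If $\mu=\lambda$, then $h_\tau\to h$ uniformly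 on compact subsets of $\Delta$ as $\tau\to1$ (unrestrictedly in $\Delta$). Consequently $h$ is univalent and belongs to $\mathrm{Spi}[1]$, i.e. it is spirallike with respect to a boundary point with $h(1)=0$; if moreover $\lambda$ is real, then $h\in S^*[1]$, i.e. $h$ is starlike with respect to a boundary point. -/

import Mathlib

open Set Filter Topology

noncomputable section

/-- The open unit disk `Δ`. -/
abbrev openDisk : Set ℂ := Metric.ball (0 : ℂ) 1

/-- The Stolz (non-tangential approach) region at a point `ζ` of the unit circle with aperture
`M`. -/
def stolzRegion (ζ : ℂ) (M : ℝ) : Set ℂ :=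
  {z | z ∈ openDisk ∧ ‖ζ - z‖ < M * (1 - ‖z‖)}

/-- `g` has the angular (non-tangential) limit `l` at the boundary point `ζ`. -/
def HasAngularLimit (g : ℂ → ℂ) (ζ l : ℂ) : Prop :=
  ∀ M : ℝ, 1 < M → Tendsto g (𝓝[stolzRegion ζ M] ζ) (𝓝 l)

/-- A one-parameter continuous semigroup of holomorphic self-mappings of the disk. Only the values
`F t z` with `0 ≤ t` and `z ∈ Δ` matter. -/
structure IsHolSemigroup (F : ℝ → ℂ → ℂ) : Prop where
  differentiableOn : ∀ t, 0 ≤ t → DifferentiableOn ℂ (F t) openDisk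
  mapsTo : ∀ t, 0 ≤ t → MapsTo (F t) openDisk openDisk
  add : ∀ s t, 0 ≤ s → 0 ≤ t → ∀ z ∈ openDisk, F (t + s) z = F t (F s z)
  zero : ∀ z ∈ openDisk, F 0 z = z
  continuousOn : ∀ z ∈ openDisk, ContinuousOn (fun t => F t z) (Ici 0)

/-- `f` belongs to the class `𝒢` of infinitesimal generators: `f` is holomorphic on the disk and
`f z = lim_{t → 0⁺} (z - F t z) / t` for some one-parameter continuous semigroup `F`. -/
def IsHolGenerator (f : ℂ → ℂ) : Prop :=
  DifferentiableOn ℂ f openDisk ∧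
    ∃ F : ℝ → ℂ → ℂ, IsHolSemigroup F ∧
      ∀ z ∈ openDisk, Tendsto (fun t : ℝ => (z - F t z) / (t : ℂ)) (𝓝[>] 0) (𝓝 (f z))

/-- `f` belongs to `𝒢⁺[ζ]`, `ζ` on the unit circle, with angular derivative `f'(ζ) = β > 0`. -/
structure IsPosGenerator (f : ℂ → ℂ) (ζ : ℂ) (β : ℝ) : Prop where
  isGenerator : IsHolGenerator f
  angularLimit : HasAngularLimit f ζ 0
  angularDeriv : HasAngularLimit (fun z => f z / (z - ζ)) ζ (β : ℂ)
  pos : 0 < β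

/-- The punctured closed disk `Ω₊ = {w ≠ 0 : |w - β| ≤ β}`. -/
def omegaPlus (β : ℝ) : Set ℂ :=
  {w | ‖w - (β : ℂ)‖ ≤ β ∧ w ≠ 0}

/-- Univalent functions on the disk. -/
def IsUnivalent (h : ℂ → ℂ) : Prop :=
  DifferentiableOn ℂ h openDisk ∧ InjOn h openDisk

/-- Starlike functions: univalent, and the image contains the segments `(0, h z]`. -/
def IsStarlike (h : ℂ → ℂ) : Prop :=
  IsUnivalent h ∧
    ∀ z ∈ openDisk, ∀ t : ℝ, 0 < t → t ≤ 1 → (t : ℂ) * h z ∈ h '' openDisk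

/-- Spirallike functions: univalent, and for some `μ` with `Re μ > 0` the image contains the spirals
`{exp (-t μ) h z : t ≥ 0}`. -/
def IsSpirallike (h : ℂ → ℂ) : Prop :=
  IsUnivalent h ∧
    ∃ μ : ℂ, 0 < μ.re ∧
      ∀ z ∈ openDisk, ∀ t : ℝ, 0 ≤ t → Complex.exp (-(t : ℂ) * μ) * h z ∈ h '' openDisk

/-- The condition `h(τ) = 0` for `τ` in the closed disk: an ordinary zero for `τ` in the disk; for
`τ` on the unit circle the angular limit at `τ` is zero and `0` is a boundary point of the image. -/
def VanishesAt (h : ℂ → ℂ) (τ : ℂ) : Prop :=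
  (τ ∈ openDisk ∧ h τ = 0) ∨
    (‖τ‖ = 1 ∧ HasAngularLimit h τ 0 ∧ (0 : ℂ) ∈ frontier (h '' openDisk))

/-- The class `S*[τ]`. -/
def starlikeClass (τ : ℂ) : Set (ℂ → ℂ) :=
  {h | IsStarlike h ∧ VanishesAt h τ}

/-- The class `Spi[τ]`. -/
def spirallikeClass (τ : ℂ) : Set (ℂ → ℂ) :=
  {h | IsSpirallike h ∧ VanishesAt h τ}

/-- `L` is the holomorphic branch of `log h` on the disk with `L 0 = 0` (for `h 0 = 1`). The power
`h ^ a` with `(h ^ a) 0 = 1` is then `exp (a * L)`. -/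
structure IsLogBranch (h L : ℂ → ℂ) : Prop where
  differentiableOn : DifferentiableOn ℂ L openDisk
  zero : L 0 = 0
  exp_eq : ∀ z ∈ openDisk, Complex.exp (L z) = h z

/-- The perturbed function
`h_τ(z) = h(z) ^ (μ / l) * (z - τ) * (1 - z τ̄) ^ (μ / μ̄) / (-(1 - z) ^ (1 + μ / μ̄))`, where
`L` is the branch of `log h`. The other powers are principal: `1 - z τ̄` and `1 - z` have positive
real part on the disk. -/
def perturbed (L : ℂ → ℂ) (l μ τ z : ℂ) : ℂ :=
  Complex.exp (μ / l * L z) *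
    ((z - τ) * (1 - z * starRingEnd ℂ τ) ^ (μ / starRingEnd ℂ μ) /
      (-(1 - z) ^ (1 + μ / starRingEnd ℂ μ)))

end

/-! Differentiating Schwarz–Pick for `F t` at `t = 0`, and letting one of the two points tend
radially to `1`, gives the Julia-type bound Re(-f/(1-z)²) ≥ (β/2) Re((1+z)/(1-z))
(`IsPosGenerator.julia_inequality`). Hence f has no zero in the disk, and h'/h = λ/f integrates to a
logarithm of h. In h_τ'/h_τ the number λ cancels, and h_τ is univalent and spirallike about τ with
exponent μ once Re[(1 - z τ̄)(z - τ) h_τ'/(μ h_τ)] > 0 (`spirallike_criterion`). The Cayley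
transform turns this into a half-plane inequality fed by the Julia bound and by Re(1/μ) ≥ 1/(2β),
which is what μ ∈ Ω₊ means; the exponent μ/μ̄ is the one that makes the leftover terms purely
imaginary (`perturbed_re_pos`). For μ = λ the factor multiplying h tends to 1 as τ → 1, so Hurwitz's
theorem makes h univalent. Invariance of the image of h under the spirals needs no limit: the
equation for h gives h ∘ F_t = e^{-tλ} h (`koenigs_semigroup`). -/

open ComplexConjugate

/-! ### Disk automorphisms and the Schwarz–Pick lemma. -/

/-- The disk automorphism `ζ ↦ (ζ + a) / (1 + ā ζ)`. -/
noncomputable def diskMobius (a ζ : ℂ) : ℂ := (ζ + a) / (1 + conj a * ζ)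

lemma mem_openDisk {z : ℂ} : z ∈ openDisk ↔ ‖z‖ < 1 := by simp [openDisk]

lemma isOpen_openDisk : IsOpen openDisk := Metric.isOpen_ball

lemma openDisk_mem_nhds {z : ℂ} (hz : z ∈ openDisk) : openDisk ∈ 𝓝 z :=
  isOpen_openDisk.mem_nhds hz

lemma neg_mem_openDisk {z : ℂ} (hz : z ∈ openDisk) : -z ∈ openDisk := by
  rw [mem_openDisk] at *; simpa using hz

lemma normSq_lt_one_of_mem_openDisk {z : ℂ} (hz : z ∈ openDisk) : Complex.normSq z < 1 := by
  rw [mem_openDisk] at hz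
  rw [Complex.normSq_eq_norm_sq]
  nlinarith [norm_nonneg z]

lemma norm_conj_mul_lt_one {a z : ℂ} (ha : a ∈ openDisk) (hz : z ∈ openDisk) :
    ‖conj a * z‖ < 1 := by
  rw [mem_openDisk] at *
  rw [norm_mul, RCLike.norm_conj]
  nlinarith [norm_nonneg a, norm_nonneg z]

lemma one_add_conj_mul_mem_slitPlane {a z : ℂ} (ha : a ∈ openDisk) (hz : z ∈ openDisk) :
    1 + conj a * z ∈ Complex.slitPlane :=
  Complex.mem_slitPlane_of_norm_lt_one (norm_conj_mul_lt_one ha hz)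

lemma one_add_conj_mul_ne_zero {a z : ℂ} (ha : a ∈ openDisk) (hz : z ∈ openDisk) :
    1 + conj a * z ≠ 0 :=
  Complex.slitPlane_ne_zero (one_add_conj_mul_mem_slitPlane ha hz)

lemma one_sub_ne_zero_of_mem_openDisk {z : ℂ} (hz : z ∈ openDisk) : 1 - z ≠ 0 := by
  rw [mem_openDisk] at hz
  intro h
  rw [← sub_eq_zero.1 h] at hz
  simp at hz

lemma normSq_one_add_conj_mul_sub (a z : ℂ) :
    Complex.normSq (1 + conj a * z) - Complex.normSq (z + a) =
      (1 - Complex.normSq a) * (1 - Complex.normSq z) := by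
  simp [Complex.normSq_apply]; ring

lemma mapsTo_diskMobius {a : ℂ} (ha : a ∈ openDisk) :
    MapsTo (diskMobius a) openDisk openDisk := by
  intro z hz
  have h1 := normSq_one_add_conj_mul_sub a z
  have h2 := normSq_lt_one_of_mem_openDisk ha
  have h3 := normSq_lt_one_of_mem_openDisk hz
  have h4 := one_add_conj_mul_ne_zero ha hz
  rw [mem_openDisk, diskMobius, norm_div, div_lt_one (norm_pos_iff.2 h4)]
  rw [Complex.normSq_eq_norm_sq, Complex.normSq_eq_norm_sq] at h1
  have h5 : 0 < (1 - Complex.normSq a) * (1 - Complex.normSq z) :=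
    mul_pos (by linarith) (by linarith)
  exact lt_of_pow_lt_pow_left₀ 2 (norm_nonneg _) (by linarith)

lemma differentiableOn_diskMobius {a : ℂ} (ha : a ∈ openDisk) :
    DifferentiableOn ℂ (diskMobius a) openDisk := by
  unfold diskMobius
  exact DifferentiableOn.div (by fun_prop) (by fun_prop)
    fun z hz => one_add_conj_mul_ne_zero ha hz

lemma diskMobius_diskMobius_neg {a z : ℂ} (ha : a ∈ openDisk) (hz : z ∈ openDisk) :
    diskMobius a (diskMobius (-a) z) = z := by
  have h1 := one_add_conj_mul_ne_zero (neg_mem_openDisk ha) hz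
  have h2 := one_add_conj_mul_ne_zero ha (mapsTo_diskMobius (neg_mem_openDisk ha) hz)
  unfold diskMobius at *
  rw [div_eq_iff h2]
  have h3 : 1 - z * conj a ≠ 0 := by
    convert h1 using 1
    simp only [map_neg]; ring
  have h4 : 1 + conj (-a) * z = 1 - z * conj a := by rw [map_neg]; ring
  rw [h4, mul_add, mul_one, div_add' _ _ _ h3, div_eq_iff h3, add_mul, mul_assoc z (conj a * _),
    mul_assoc (conj a), div_mul_cancel₀ _ h3]
  ring

/-- The **Schwarz–Pick lemma** for holomorphic self-maps of the unit disk. -/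
lemma schwarz_pick {F : ℂ → ℂ} (hF : DifferentiableOn ℂ F openDisk)
    (hm : MapsTo F openDisk openDisk) {z u : ℂ} (hz : z ∈ openDisk) (hu : u ∈ openDisk) :
    Complex.normSq (F z - F u) * Complex.normSq (1 - conj u * z) ≤
      Complex.normSq (z - u) * Complex.normSq (1 - conj (F u) * F z) := by
  have hFu := neg_mem_openDisk (hm hu)
  have hζ := mapsTo_diskMobius (neg_mem_openDisk hu) hz
  -- Conjugating by automorphisms that move `u` and `F u` to `0` gives a self-map fixing `0`, to
  -- which the Schwarz lemma applies.
  have key := Complex.norm_le_norm_of_mapsTo_ball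
    (f := diskMobius (-F u) ∘ F ∘ diskMobius u) (R := 1) (z := diskMobius (-u) z)
    ((differentiableOn_diskMobius hFu).comp
      (hF.comp (differentiableOn_diskMobius hu) (mapsTo_diskMobius hu))
      (hm.comp (mapsTo_diskMobius hu)))
    (((mapsTo_diskMobius hFu).comp (hm.comp (mapsTo_diskMobius hu))).mono_right
      Metric.ball_subset_closedBall) (by simp [diskMobius]) (mem_openDisk.1 hζ)
  simp only [Function.comp_apply, diskMobius_diskMobius_neg hu hz] at key
  have e1 := one_add_conj_mul_ne_zero (neg_mem_openDisk hu) hz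
  have e2 := one_add_conj_mul_ne_zero hFu (hm hz)
  simp only [diskMobius, norm_div] at key
  rw [div_le_div_iff₀ (norm_pos_iff.2 e2) (norm_pos_iff.2 e1)] at key
  have := pow_le_pow_left₀ (by positivity) key 2
  simpa [mul_pow, ← Complex.normSq_eq_norm_sq, sub_eq_add_neg] using this

/-! ### Semigroups, generators and the Julia-type inequality. -/

/-- The orbits of a semigroup are differentiable from the right, with velocity `-f`. -/
lemma hasDerivWithinAt_orbit {F : ℝ → ℂ → ℂ} {f : ℂ → ℂ} (hF : IsHolSemigroup F)
    (hf : ∀ z ∈ openDisk, Tendsto (fun t : ℝ => (z - F t z) / (t : ℂ)) (𝓝[>] 0) (𝓝 (f z)))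
    {z : ℂ} (hz : z ∈ openDisk) {t : ℝ} (ht : 0 ≤ t) :
    HasDerivWithinAt (fun s => F s z) (-f (F t z)) (Ici t) t := by
  rw [← hasDerivWithinAt_Ioi_iff_Ici, hasDerivWithinAt_iff_tendsto_slope' (by simp)]
  have h1 := (hf _ (hF.mapsTo t ht hz)).neg
  have h2 : Tendsto (fun s : ℝ => s - t) (𝓝[>] t) (𝓝[>] 0) := by
    refine tendsto_nhdsWithin_iff.2 ⟨?_, ?_⟩
    · have : Tendsto (fun s : ℝ => s - t) (𝓝 t) (𝓝 (t - t)) := by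
        exact (continuous_id.sub continuous_const).tendsto t
      rw [sub_self] at this
      exact this.mono_left nhdsWithin_le_nhds
    · filter_upwards [self_mem_nhdsWithin] with s hs
      simpa using hs
  refine (h1.comp h2).congr' ?_
  filter_upwards [self_mem_nhdsWithin] with s hs
  have hs' : t < s := hs
  have := hF.add t (s - t) ht (by linarith) z hz
  rw [sub_add_cancel] at this
  simp only [Function.comp_apply, slope_def_module, ← this, Complex.real_smul, Complex.ofReal_inv]
  rw [div_eq_inv_mul, ← mul_neg, neg_sub]

lemma deriv_right_nonneg {D : ℝ → ℝ} {D' : ℝ} (h : HasDerivWithinAt D D' (Ici 0) 0)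
    (h0 : D 0 = 0) (hpos : ∀ t, 0 ≤ t → 0 ≤ D t) : 0 ≤ D' := by
  rw [← hasDerivWithinAt_Ioi_iff_Ici, hasDerivWithinAt_iff_tendsto_slope' (by simp)] at h
  refine ge_of_tendsto h ?_
  filter_upwards [self_mem_nhdsWithin] with s hs
  have hs' : 0 < s := hs
  simp only [slope_def_field, h0, sub_zero]
  exact div_nonneg (hpos s hs'.le) hs'.le

lemma HasDerivWithinAt.normSq {u : ℝ → ℂ} {u' : ℂ} {s : Set ℝ} {t : ℝ}
    (h : HasDerivWithinAt u u' s t) :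
    HasDerivWithinAt (fun t => Complex.normSq (u t)) (2 * (conj (u t) * u').re) s t := by
  have h1 : HasDerivWithinAt (fun t => (u t).re) u'.re s t :=
    (Complex.reCLM.hasFDerivAt (x := u t)).comp_hasDerivWithinAt t h
  have h2 : HasDerivWithinAt (fun t => (u t).im) u'.im s t :=
    (Complex.imCLM.hasFDerivAt (x := u t)).comp_hasDerivWithinAt t h
  simp only [Complex.normSq_apply]
  refine ((h1.mul h1).add (h2.mul h2)).congr_deriv ?_
  simp only [Complex.mul_re, Complex.conj_re, Complex.conj_im]
  ring

lemma HasDerivWithinAt.complex_conj {u : ℝ → ℂ} {u' : ℂ} {s : Set ℝ} {t : ℝ}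
    (h : HasDerivWithinAt u u' s t) :
    HasDerivWithinAt (fun t => conj (u t)) (conj u') s t :=
  (Complex.conjCLE.toContinuousLinearMap.hasFDerivAt (x := u t)).comp_hasDerivWithinAt t h

/-- Infinitesimal form of the Schwarz–Pick lemma for a semigroup generator. -/
lemma generator_two_point {f : ℂ → ℂ} (hf : IsHolGenerator f) {z u : ℂ} (hz : z ∈ openDisk)
    (hu : u ∈ openDisk) :
    0 ≤ Complex.normSq (z - u) *
          (conj (1 - conj u * z) * (conj (f u) * z + conj u * f z)).re +
        Complex.normSq (1 - conj u * z) * (conj (z - u) * (f z - f u)).re := by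
  obtain ⟨-, F, hF, hlim⟩ := hf
  have dz := hasDerivWithinAt_orbit hF hlim hz le_rfl
  have du := hasDerivWithinAt_orbit hF hlim hu le_rfl
  rw [hF.zero z hz] at dz
  rw [hF.zero u hu] at du
  have d1 := ((du.complex_conj.mul dz).const_sub 1).normSq.const_mul (Complex.normSq (z - u))
  have d2 := (dz.sub du).normSq.const_mul (Complex.normSq (1 - conj u * z))
  -- The difference of the two sides of Schwarz–Pick for `F t` is nonnegative and vanishes at `t =
  -- 0`, so its right derivative there is nonnegative.
  have d := deriv_right_nonneg (d1.sub d2) (by simp [hF.zero z hz, hF.zero u hu]; ring) (by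
    intro t ht
    have := schwarz_pick (hF.differentiableOn t ht) (hF.mapsTo t ht) hz hu
    simp only [Pi.sub_apply, Pi.mul_apply]
    linarith)
  simp only [Pi.sub_apply, Pi.mul_apply, hF.zero z hz, hF.zero u hu] at d
  have e1 : -(conj (-f u) * z + conj u * -f z) = conj (f u) * z + conj u * f z := by
    simp only [map_neg]; ring
  have e2 : conj (z - u) * (-f z - -f u) = -(conj (z - u) * (f z - f u)) := by ring
  rw [e1, e2, Complex.neg_re] at d
  nlinarith

/-- A generator with positive angular derivative at `1` satisfies the Julia-type inequality. -/
lemma IsPosGenerator.julia_inequality {f : ℂ → ℂ} {β : ℝ} (hf : IsPosGenerator f 1 β) {z : ℂ}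
    (hz : z ∈ openDisk) :
    β * Complex.normSq (1 - z) * (1 - Complex.normSq z) ≤ -2 * (f z * conj (1 - z) ^ 2).re := by
  have hmem : ∀ r : ℝ, r ∈ Ioo (0 : ℝ) 1 → (r : ℂ) ∈ openDisk := by
    intro r hr
    rw [mem_openDisk, Complex.norm_real, Real.norm_eq_abs, abs_of_pos hr.1]; exact hr.2
  have hIoo : Ioo (0 : ℝ) 1 ∈ 𝓝[<] (1 : ℝ) := Ioo_mem_nhdsLT one_pos
  have hb : Tendsto (fun r : ℝ => f r / ((r : ℂ) - 1)) (𝓝[<] 1) (𝓝 (β : ℂ)) := by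
    -- Radial approach stays in every Stolz region, since |1 - r| = 1 - r; the aperture 2 is
    -- arbitrary.
    refine (hf.angularDeriv 2 one_lt_two).comp (f := fun r : ℝ => (r : ℂ)) ?_
    refine tendsto_nhdsWithin_iff.2 ⟨?_, ?_⟩
    · have := Complex.continuous_ofReal.tendsto 1
      rw [Complex.ofReal_one] at this
      exact this.mono_left nhdsWithin_le_nhds
    · filter_upwards [hIoo] with r hr
      refine ⟨hmem r hr, ?_⟩
      rw [← Complex.ofReal_one, ← Complex.ofReal_sub, Complex.norm_real, Complex.norm_real,
        Real.norm_eq_abs, Real.norm_eq_abs, abs_of_pos hr.1, abs_of_pos (by linarith [hr.2])]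
      linarith [hr.2]
  -- What remains of the two-point inequality at `u = r` after the factor `1 - r` is taken out, with
  -- f(r)/(r - 1) as a free variable `q.2`. It is continuous up to `r = 1`.
  let Φ : ℝ × ℂ → ℝ := fun q =>
    Complex.normSq (1 - q.1 * z) * (1 + q.1) * (f z * conj z).re
      - (1 + q.1) * (1 - Complex.normSq z) * q.1 * ((1 - q.1 * conj z) * f z).re
      - Complex.normSq (z - q.1) * ((1 - q.1 * conj z) * conj q.2 * z).re
      + Complex.normSq (1 - q.1 * z) * ((conj z - q.1) * q.2).re
  have hΦ : Continuous Φ := by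
    have := Complex.continuous_normSq
    have hc := Complex.continuous_conj
    have hre := Complex.continuous_re
    simp only [Φ]
    fun_prop
  have hr1 : Tendsto (fun r : ℝ => r) (𝓝[<] 1) (𝓝 1) := nhdsWithin_le_nhds
  have hlim := (hΦ.tendsto (1, (β : ℂ))).comp (hr1.prodMk_nhds hb)
  have hge : 0 ≤ Φ (1, (β : ℂ)) := by
    refine ge_of_tendsto hlim ?_
    filter_upwards [hIoo] with r hr
    have h := generator_two_point hf.isGenerator hz (hmem r hr)
    set b := f r / ((r : ℂ) - 1) with hbdef
    have hfr : f r = ((r : ℂ) - 1) * b := by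
      have : (r : ℂ) - 1 ≠ 0 := by
        rw [← Complex.ofReal_one, ← Complex.ofReal_sub]
        exact Complex.ofReal_ne_zero.2 (by linarith [hr.2])
      rw [hbdef]; field_simp
    rw [hfr] at h
    have key : 0 ≤ (1 - r) * Φ (r, b) := by
      refine h.trans_eq ?_
      simp [Φ, Complex.normSq_apply]
      ring
    exact nonneg_of_mul_nonneg_right key (by linarith [hr.2])
  simp [Φ, Complex.normSq_apply, pow_two] at hge ⊢
  nlinarith

/-! ### The disk Ω₊ and the positivity inequality in the half-plane. -/

lemma normSq_le_of_mem_omegaPlus {β : ℝ} {μ : ℂ} (hμ : μ ∈ omegaPlus β) :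
    Complex.normSq μ ≤ 2 * β * μ.re := by
  have h1 := pow_le_pow_left₀ (norm_nonneg _) hμ.1 2
  rw [← Complex.normSq_eq_norm_sq] at h1
  simp only [Complex.normSq_apply, Complex.sub_re, Complex.sub_im, Complex.ofReal_re,
    Complex.ofReal_im] at h1 ⊢
  nlinarith

lemma re_pos_of_mem_omegaPlus {β : ℝ} (hβ : 0 < β) {μ : ℂ} (hμ : μ ∈ omegaPlus β) :
    0 < μ.re := by
  have h1 := normSq_le_of_mem_omegaPlus hμ
  have h2 := Complex.normSq_pos.2 hμ.2
  exact pos_of_mul_pos_right (h2.trans_le h1) (by positivity)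

/-- Inversion carries the disk, whose boundary circle passes through 0, to a half-plane. -/
lemma le_re_inv_of_mem_omegaPlus {β : ℝ} (hβ : 0 < β) {μ : ℂ} (hμ : μ ∈ omegaPlus β) :
    1 / (2 * β) ≤ (μ⁻¹).re := by
  have h1 := normSq_le_of_mem_omegaPlus hμ
  rw [Complex.inv_re, div_le_div_iff₀ (by positivity) (Complex.normSq_pos.2 hμ.2)]
  linarith

/-- The expression equals (wp + r²)/(w + p). Multiplying by the conjugate denominator leaves |w|² Re
p + |p|² Re w + r² (Re w + Re p), where every term is nonnegative and r² Re w is positive. -/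
lemma halfPlane_re_pos {w p : ℂ} {r : ℝ} (hw : 0 < w.re) (hp : 0 ≤ p.re) (hr : 0 < r) :
    0 < (w - (w ^ 2 - (r : ℂ) ^ 2) / (w + p)).re := by
  have hne : w + p ≠ 0 := by
    intro h
    have := congrArg Complex.re h
    simp at this
    linarith
  have h1 : w - (w ^ 2 - (r : ℂ) ^ 2) / (w + p) = (w * p + (r : ℂ) ^ 2) / (w + p) := by
    field_simp; ring
  rw [h1, Complex.div_re, ← add_div]
  refine div_pos ?_ (Complex.normSq_pos.2 hne)
  have h2 : (w * p + (r : ℂ) ^ 2).re * (w + p).re + (w * p + (r : ℂ) ^ 2).im * (w + p).im =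
      Complex.normSq w * p.re + Complex.normSq p * w.re + r ^ 2 * (w.re + p.re) := by
    simp [Complex.normSq_apply, pow_two]; ring
  rw [h2]
  have h3 := Complex.normSq_nonneg w
  have h4 := Complex.normSq_nonneg p
  positivity

lemma cayley_re (z : ℂ) :
    ((1 + z) / (1 - z)).re = (1 - Complex.normSq z) / Complex.normSq (1 - z) := by
  rw [Complex.div_re, ← add_div]
  simp [Complex.normSq_apply]; ring

lemma cayley_re_pos {z : ℂ} (hz : z ∈ openDisk) : 0 < ((1 + z) / (1 - z)).re := by
  rw [cayley_re z]
  exact div_pos (by linarith [normSq_lt_one_of_mem_openDisk hz])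
    (Complex.normSq_pos.2 (one_sub_ne_zero_of_mem_openDisk hz))

lemma one_sub_mul_conj_mem_slitPlane {z τ : ℂ} (hz : z ∈ openDisk) (hτ : τ ∈ openDisk) :
    1 - z * conj τ ∈ Complex.slitPlane := by
  have := one_add_conj_mul_mem_slitPlane (neg_mem_openDisk hτ) hz
  rwa [map_neg, neg_mul, ← sub_eq_add_neg, mul_comm] at this

/-- The logarithmic derivative of the perturbed function satisfies the spirallikeness inequality
with respect to `τ`. The number `y` stands for the value at `z` of the generator. -/
lemma perturbed_re_pos {β : ℝ} (hβ : 0 < β) {μ z τ y : ℂ} (hμ : μ ∈ omegaPlus β)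
    (hz : z ∈ openDisk) (hτ : τ ∈ openDisk) (hy0 : y ≠ 0)
    (hy : β * Complex.normSq (1 - z) * (1 - Complex.normSq z) ≤ -2 * (y * conj (1 - z) ^ 2).re) :
    0 < ((1 - z * conj τ) * (1 + (z - τ) * (μ / y - μ / conj μ * (conj τ / (1 - z * conj τ)) +
      (1 + μ / conj μ) / (1 - z))) / μ).re := by
  have hz1 := one_sub_ne_zero_of_mem_openDisk hz
  have hτ1 := one_sub_ne_zero_of_mem_openDisk hτ
  have hτ1' : 1 - conj τ ≠ 0 := by
    intro h
    apply hτ1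
    simpa using congrArg conj h
  have hzτ := Complex.slitPlane_ne_zero (one_sub_mul_conj_mem_slitPlane hz hτ)
  have hμ0 : μ ≠ 0 := hμ.2
  have hμ0' : conj μ ≠ 0 := by simpa using hμ0
  set w := (1 + z) / (1 - z) with hw
  set σ := (1 + τ) / (1 - τ) with hσ
  set m := μ⁻¹ with hm
  have hwre : 0 < w.re := cayley_re_pos hz
  have hσre : 0 < σ.re := cayley_re_pos hτ
  set P := -y / (1 - z) ^ 2 with hP
  have hβ' : (β : ℂ) ≠ 0 := Complex.ofReal_ne_zero.2 hβ.ne'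
  -- The vertical shift moves σ to the real point `σ.re`, which plays the role of `r` in
  -- `halfPlane_re_pos`. The Julia bound says precisely that `p'` has nonnegative real part.
  set w' := w - σ.im * Complex.I with hw'
  set p' := 2 * P / β - w' with hp'
  have hw're : w'.re = w.re := by simp [hw']
  have hPre : β / 2 * w.re ≤ P.re := by
    have hn := Complex.normSq_pos.2 hz1
    have e : P = -(y * conj (1 - z) ^ 2) / ((Complex.normSq (1 - z) ^ 2 : ℝ) : ℂ) := by
      have hc : conj (1 - z) ≠ 0 := (map_ne_zero _).2 hz1
      rw [hP]
      push_cast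
      rw [← Complex.mul_conj, mul_pow]
      field_simp
    rw [e, Complex.div_ofReal_re, hw, cayley_re z, Complex.neg_re, le_div_iff₀ (by positivity)]
    have : β / 2 * ((1 - Complex.normSq z) / Complex.normSq (1 - z)) * Complex.normSq (1 - z) ^ 2 =
      (β * Complex.normSq (1 - z) * (1 - Complex.normSq z)) / 2 := by field_simp
    rw [this]
    linarith
  have hp're : 0 ≤ p'.re := by
    have e : p'.re = 2 * P.re / β - w.re := by
      have e0 : p' = ((2 / β : ℝ) : ℂ) * P - w' := by
        rw [hp']; push_cast; ring
      rw [e0, Complex.sub_re, Complex.re_ofReal_mul, hw're]; ring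
    rw [e, sub_nonneg, le_div_iff₀ hβ]
    linarith
  have hpos := halfPlane_re_pos (w := w') (hw're ▸ hwre) hp're hσre
  have hwp : w' + p' = 2 * P / β := by rw [hp']; ring
  have e1 : w' ^ 2 - (σ.re : ℂ) ^ 2 = (w - σ) * (w + conj σ) := by
    have : conj σ = (σ.re : ℂ) - σ.im * Complex.I := by
      apply Complex.ext <;> simp
    have h2 := Complex.re_add_im σ
    rw [this, hw']
    linear_combination (-(w + σ.re - σ.im * Complex.I)) * h2
  have e2 : (w - σ) * (w + conj σ) =
      4 * (z - τ) * (1 - z * conj τ) / ((1 - z) ^ 2 * ((1 - τ) * (1 - conj τ))) := by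
    rw [hw, hσ, map_div₀, map_add, map_sub, map_one]
    field_simp
    ring
  have hP0 : P ≠ 0 := div_ne_zero (neg_ne_zero.2 hy0) (pow_ne_zero 2 hz1)
  have hmc : conj m = (conj μ)⁻¹ := by rw [hm, map_inv₀]
  -- Only the term in `1 / y` and the term in `w` contribute to the real part: conj τ - τ and m -
  -- conj m are imaginary, and their coefficients are real.
  have key : (1 - z * conj τ) * (1 + (z - τ) * (μ / y - μ / conj μ *
        (conj τ / (1 - z * conj τ)) + (1 + μ / conj μ) / (1 - z))) / μ =
      (z - τ) * (1 - z * conj τ) / y + (m + conj m) / 2 * ((1 - τ) * (1 - conj τ) * w +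
        (conj τ - τ)) + (m - conj m) / 2 * (1 - τ * conj τ) := by
    rw [hmc, hm, hw]
    field_simp
    ring
  have key2 : (z - τ) * (1 - z * conj τ) / y =
      ((Complex.normSq (1 - τ) / (2 * β) : ℝ) : ℂ) *
        (-((w' ^ 2 - (σ.re : ℂ) ^ 2) / (w' + p'))) := by
    rw [hwp, e1, e2, hP]
    push_cast
    rw [← Complex.mul_conj, map_sub, map_one]
    field_simp
    ring
  have r1 : (m + conj m) / 2 = (m.re : ℂ) := by
    rw [Complex.add_conj]; push_cast; ring
  have r2 : (m - conj m) / 2 * (1 - τ * conj τ) =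
      ((m.im * (1 - Complex.normSq τ) : ℝ) : ℂ) * Complex.I := by
    rw [Complex.sub_conj, Complex.mul_conj]; push_cast; ring
  have r3 : (1 - τ) * (1 - conj τ) = (Complex.normSq (1 - τ) : ℂ) := by
    rw [← Complex.mul_conj, map_sub, map_one]
  have hn := Complex.normSq_pos.2 hτ1
  have hmre := le_re_inv_of_mem_omegaPlus hβ hμ
  rw [key, key2, r1, r2, r3]
  have : (-((w' ^ 2 - (σ.re : ℂ) ^ 2) / (w' + p'))).re > - w.re := by
    rw [Complex.sub_re, hw're] at hpos
    rw [Complex.neg_re]; linarith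
  simp only [Complex.add_re, Complex.re_ofReal_mul, Complex.I_re, mul_zero, add_zero,
    Complex.sub_re, Complex.conj_re, sub_self]
  have h5 : Complex.normSq (1 - τ) / (2 * β) * -w.re <
      Complex.normSq (1 - τ) / (2 * β) * (-((w' ^ 2 - (σ.re : ℂ) ^ 2) / (w' + p'))).re :=
    mul_lt_mul_of_pos_left this (by positivity)
  have h6 : 1 / (2 * β) * (Complex.normSq (1 - τ) * w.re) ≤
      m.re * (Complex.normSq (1 - τ) * w.re) :=
    mul_le_mul_of_nonneg_right hmre (by positivity)
  have h7 : Complex.normSq (1 - τ) / (2 * β) * -w.re =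
    -(1 / (2 * β) * (Complex.normSq (1 - τ) * w.re)) := by ring
  linarith

lemma IsPosGenerator.ne_zero {f : ℂ → ℂ} {β : ℝ} (hf : IsPosGenerator f 1 β) {z : ℂ}
    (hz : z ∈ openDisk) : f z ≠ 0 := by
  intro h
  have h1 := hf.julia_inequality hz
  have h2 := Complex.normSq_pos.2 (one_sub_ne_zero_of_mem_openDisk hz)
  have h3 := normSq_lt_one_of_mem_openDisk hz
  have h4 : 0 < β * Complex.normSq (1 - z) * (1 - Complex.normSq z) :=
    mul_pos (mul_pos hf.pos h2) (by linarith)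
  simp [h] at h1
  linarith

/-! ### From the differential inequality to univalence and spiral-invariant images. -/

/-- **Noshiro–Warschawski**: on a convex set, a function whose derivative has positive real part
after multiplication by a constant is injective. -/
lemma injOn_of_re_deriv_mul_pos {K K' : ℂ → ℂ} {s : Set ℂ} (hs : Convex ℝ s) (m : ℂ)
    (hK : ∀ z ∈ s, HasDerivAt K (K' z) z) (hpos : ∀ z ∈ s, 0 < (K' z * m).re) : InjOn K s := by
  intro a ha b hb hab
  by_contra hne
  have hba : b - a ≠ 0 := sub_ne_zero.2 (Ne.symm hne)
  have hmem : ∀ t ∈ Icc (0 : ℝ) 1, a + t * (b - a) ∈ s := by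
    intro t ht
    have := hs.add_smul_sub_mem ha hb ht
    simpa [Complex.real_smul] using this
  let g : ℝ → ℝ := fun t => (K (a + t * (b - a)) * m / (b - a)).re
  have hg : ∀ t ∈ Icc (0 : ℝ) 1, HasDerivAt g ((K' (a + t * (b - a)) * m).re) t := by
    intro t ht
    have h1 : HasDerivAt (fun t : ℝ => a + (t : ℂ) * (b - a)) (b - a) t := by
      simpa using ((Complex.ofRealCLM.hasDerivAt (x := t)).mul_const (b - a)).const_add a
    have h2 := (((hK _ (hmem t ht)).comp t h1).mul_const m).div_const (b - a)
    have h3 := (Complex.reCLM.hasFDerivAt (x := K (a + t * (b - a)) * m / (b - a))).comp_hasDerivAt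
      t h2
    refine h3.congr_deriv ?_
    rw [Complex.reCLM_apply]
    congr 1
    field_simp
  have hmono : StrictMonoOn g (Icc 0 1) := by
    refine strictMonoOn_of_deriv_pos (convex_Icc 0 1)
      (fun t ht => (hg t ht).continuousAt.continuousWithinAt) fun t ht => ?_
    have ht' := interior_subset ht
    rw [(hg t ht').deriv]
    exact hpos _ (hmem t ht')
  have := hmono (left_mem_Icc.2 zero_le_one) (right_mem_Icc.2 zero_le_one) one_pos
  simp [g, hab] at this

/-- Substituting z = e^ω lifts the logarithm of the function to ω + l(e^ω) on the convex left
half-plane. Its derivative is 1 + z l'(z), so Noshiro–Warschawski applies there. -/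
lemma injOn_id_mul_exp {l l' : ℂ → ℂ} {μ : ℂ}
    (hl : ∀ z ∈ openDisk, HasDerivAt l (l' z) z)
    (hpos : ∀ z ∈ openDisk, 0 < ((1 + z * l' z) / μ).re) :
    InjOn (fun z => z * Complex.exp (l z)) openDisk := by
  let s : Set ℂ := {ω | ω.re < 0}
  have hs : Convex ℝ s := convex_halfSpace_re_lt 0
  have hexp : ∀ ω ∈ s, Complex.exp ω ∈ openDisk := by
    intro ω hω
    rw [mem_openDisk, Complex.norm_exp]
    simpa [s] using hω
  have hinj : InjOn (fun ω => ω + l (Complex.exp ω)) s := by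
    refine injOn_of_re_deriv_mul_pos hs μ⁻¹
      (K' := fun ω => 1 + l' (Complex.exp ω) * Complex.exp ω) (fun ω hω => ?_) fun ω hω => ?_
    · exact (hasDerivAt_id ω).add ((hl _ (hexp ω hω)).comp ω (Complex.hasDerivAt_exp ω))
    · have := hpos _ (hexp ω hω)
      rwa [div_eq_mul_inv, mul_comm (Complex.exp ω)] at this
  intro a ha b hb hab
  have hab' : a * Complex.exp (l a) = b * Complex.exp (l b) := hab
  by_cases ha0 : a = 0
  · have : b * Complex.exp (l b) = 0 := by rw [← hab', ha0, zero_mul]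
    rw [ha0, (mul_eq_zero.1 this).resolve_right (Complex.exp_ne_zero _)]
  have hb0 : b ≠ 0 := by
    rintro rfl
    rw [zero_mul] at hab'
    exact ha0 ((mul_eq_zero.1 hab').resolve_right (Complex.exp_ne_zero _))
  have hlog : ∀ z ∈ openDisk, z ≠ 0 → (Complex.log z).re < 0 := by
    intro z hz hz0
    rw [Complex.log_re]
    exact Real.log_neg (norm_pos_iff.2 hz0) (mem_openDisk.1 hz)
  have h1 : Complex.exp (Complex.log a + l a) = Complex.exp (Complex.log b + l b) := by
    rw [Complex.exp_add, Complex.exp_add, Complex.exp_log ha0, Complex.exp_log hb0, hab']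
  obtain ⟨n, hn⟩ := Complex.exp_eq_exp_iff_exists_int.1 h1
  -- The multiple of 2πi is absorbed by choosing another logarithm of `b`, which lies in the same
  -- half-plane.
  have hexpn : Complex.exp (Complex.log b + n * (2 * Real.pi * Complex.I)) = b := by
    rw [Complex.exp_add, Complex.exp_int_mul_two_pi_mul_I, mul_one, Complex.exp_log hb0]
  have h2 : Complex.log a = Complex.log b + n * (2 * Real.pi * Complex.I) := by
    refine hinj (hlog a ha ha0) ?_ ?_
    · have := hlog b hb hb0
      simpa [s] using this
    · simp only [Complex.exp_log ha0, hexpn]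
      rw [hn]; ring
  rw [← Complex.exp_log ha0, h2, hexpn]

/-- Pulled back by H, the spiral moves with d|ζ|²/dt = -2|ζ|² Re(μ/(1 + ζ l'(ζ))) < 0. Preimages
therefore move inward and stay in a compact ball, so they can be continued for all times. -/
lemma exp_mul_mem_image_id_mul_exp {l l' : ℂ → ℂ} {μ : ℂ}
    (hl : ∀ z ∈ openDisk, HasDerivAt l (l' z) z)
    (hpos : ∀ z ∈ openDisk, 0 < ((1 + z * l' z) / μ).re) {z₀ : ℂ} (hz₀ : z₀ ∈ openDisk) {t : ℝ}
    (ht : 0 ≤ t) :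
    Complex.exp (-(t : ℂ) * μ) * (z₀ * Complex.exp (l z₀)) ∈
      (fun z => z * Complex.exp (l z)) '' openDisk := by
  set H : ℂ → ℂ := fun z => z * Complex.exp (l z) with hH
  by_cases h0 : z₀ = 0
  · exact ⟨0, by simp, by simp [hH, h0]⟩
  have hsub : Metric.closedBall (0 : ℂ) ‖z₀‖ ⊆ openDisk := by
    intro z hz
    rw [mem_openDisk] at *
    exact (mem_closedBall_zero_iff.1 hz).trans_lt hz₀
  have hHd : ∀ z ∈ openDisk, HasDerivAt H (Complex.exp (l z) * (1 + z * l' z)) z := by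
    intro z hz
    refine ((hasDerivAt_id z).mul (hl z hz).cexp).congr_deriv ?_
    simp only [id]; ring
  have hcont : ContinuousOn H (Metric.closedBall (0 : ℂ) ‖z₀‖) := fun z hz =>
    (hHd z (hsub hz)).continuousAt.continuousWithinAt
  let T : Set ℝ := {s | Complex.exp (-(s : ℂ) * μ) * H z₀ ∈ H '' Metric.closedBall (0 : ℂ) ‖z₀‖}
  have hT : IsClosed T := by
    refine IsClosed.preimage (f := fun s : ℝ => Complex.exp (-(s : ℂ) * μ) * H z₀) (by fun_prop) ?_
    exact ((isCompact_closedBall _ _).image_of_continuousOn hcont).isClosed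
  suffices h : Icc 0 t ⊆ T by
    exact image_mono hsub (h (right_mem_Icc.2 ht))
  -- Continuous induction on time: `T` is closed by compactness of the ball, and a local inverse of
  -- `H` at the current preimage `z₁` pushes it further to the right.
  refine (hT.inter isClosed_Icc).Icc_subset_of_forall_exists_gt
    ⟨z₀, by simp, by simp⟩ ?_
  rintro s ⟨⟨z₁, hz₁, hs⟩, hst⟩ y hy
  have hy' : s < y := hy
  have hs' : H z₁ = Complex.exp (-(s : ℂ) * μ) * H z₀ := hs
  have hz₁d := hsub hz₁
  have hz₁0 : z₁ ≠ 0 := by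
    rintro rfl
    have : H 0 = 0 := by simp [hH]
    rw [this] at hs'
    simp [hH, h0, Complex.exp_ne_zero] at hs'
  have hp := hpos z₁ hz₁d
  have hne : 1 + z₁ * l' z₁ ≠ 0 := by
    intro h
    rw [h] at hp
    simp at hp
  have hμ : μ ≠ 0 := by
    rintro rfl
    simp at hp
  have hD := hHd z₁ hz₁d
  have hD0 : Complex.exp (l z₁) * (1 + z₁ * l' z₁) ≠ 0 := mul_ne_zero (Complex.exp_ne_zero _) hne
  have hstrict : HasStrictDerivAt H (Complex.exp (l z₁) * (1 + z₁ * l' z₁)) z₁ := by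
    have han : AnalyticAt ℂ H z₁ :=
      DifferentiableOn.analyticAt
        (fun z hz => (hHd z hz).differentiableAt.differentiableWithinAt) (openDisk_mem_nhds hz₁d)
    have := han.hasStrictDerivAt
    rwa [hD.deriv] at this
  set G := hstrict.localInverse H _ z₁ hD0 with hG
  have hGd : HasDerivAt G (Complex.exp (l z₁) * (1 + z₁ * l' z₁))⁻¹ (H z₁) :=
    (hstrict.to_localInverse hD0).hasDerivAt
  have hGz : G (H z₁) = z₁ := HasStrictFDerivAt.localInverse_apply_image _
  have hGr : ∀ᶠ v in 𝓝 (H z₁), H (G v) = v := HasStrictFDerivAt.eventually_right_inverse _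
  let v : ℝ → ℂ := fun x => Complex.exp (-(x : ℂ) * μ) * H z₁
  have hv0 : v 0 = H z₁ := by simp [v]
  have hv : HasDerivAt v (-μ * H z₁) 0 := by
    have h1 : HasDerivAt (fun x : ℝ => -(x : ℂ) * μ) (-μ) 0 := by
      simpa using (Complex.ofRealCLM.hasDerivAt (x := (0 : ℝ))).neg.mul_const μ
    have := h1.cexp.mul_const (H z₁)
    simpa [v] using this
  have hGv : HasDerivAt (fun x => G (v x))
      ((Complex.exp (l z₁) * (1 + z₁ * l' z₁))⁻¹ * (-μ * H z₁)) 0 := by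
    rw [← hv0] at hGd
    have := hGd.comp (0 : ℝ) hv
    exact this
  have hN := hGv.hasDerivWithinAt (s := Ici 0) |>.normSq
  have hneg : 2 * (conj (G (v 0)) * ((Complex.exp (l z₁) * (1 + z₁ * l' z₁))⁻¹ *
      (-μ * H z₁))).re < 0 := by
    have e : conj (G (v 0)) * ((Complex.exp (l z₁) * (1 + z₁ * l' z₁))⁻¹ * (-μ * H z₁)) =
        ((-Complex.normSq z₁ : ℝ) : ℂ) * ((1 + z₁ * l' z₁) / μ)⁻¹ := by
      rw [hv0, hGz, Complex.ofReal_neg, ← Complex.mul_conj]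
      have := Complex.exp_ne_zero (l z₁)
      simp only [hH]
      field_simp
    rw [e, Complex.re_ofReal_mul, Complex.inv_re]
    have h1 := Complex.normSq_pos.2 hz₁0
    have h2 : 0 < Complex.normSq ((1 + z₁ * l' z₁) / μ) :=
      Complex.normSq_pos.2 (div_ne_zero hne hμ)
    have h3 := mul_pos h1 (div_pos hp h2)
    linarith
  rw [← hasDerivWithinAt_Ioi_iff_Ici, hasDerivWithinAt_iff_tendsto_slope' (by simp)] at hN
  have hev := hN.eventually (gt_mem_nhds hneg)
  have hcv : Tendsto v (𝓝[>] 0) (𝓝 (H z₁)) := by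
    have := hv.continuousAt.tendsto
    rw [hv0] at this
    exact this.mono_left nhdsWithin_le_nhds
  have hIoo : Ioo (0 : ℝ) (y - s) ∈ 𝓝[>] (0 : ℝ) := Ioo_mem_nhdsGT (by linarith)
  obtain ⟨x, ⟨hx1, hx2⟩, hx3⟩ := ((hev.and (hcv.eventually hGr)).and hIoo).exists
  refine ⟨s + x, ⟨G (v x), ?_, ?_⟩, by simpa using hx3.1, by linarith [hx3.2]⟩
  · rw [slope_def_field, hv0, hGz, sub_zero, div_lt_iff₀ hx3.1, zero_mul, sub_neg,
      Complex.normSq_eq_norm_sq, Complex.normSq_eq_norm_sq] at hx1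
    rw [mem_closedBall_zero_iff] at hz₁ ⊢
    exact (lt_of_pow_lt_pow_left₀ 2 (norm_nonneg _) hx1).le.trans hz₁
  · rw [hx2]
    simp only [v]
    rw [hs', ← mul_assoc, ← Complex.exp_add]
    congr 2
    push_cast; ring

/-- A function `z ↦ C (z - τ) exp (l z)` satisfying the differential inequality of spirallike
functions with respect to the interior point `τ` is injective, and its image is invariant under
multiplication by `exp (-t μ)`. -/
lemma spirallike_criterion {l l' : ℂ → ℂ} {μ τ C : ℂ} (hτ : τ ∈ openDisk) (hC : C ≠ 0)
    (hl : ∀ z ∈ openDisk, HasDerivAt l (l' z) z)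
    (hpos : ∀ z ∈ openDisk, 0 < ((1 - z * conj τ) * (1 + (z - τ) * l' z) / μ).re) :
    InjOn (fun z => C * ((z - τ) * Complex.exp (l z))) openDisk ∧
    ∀ z ∈ openDisk, ∀ t : ℝ, 0 ≤ t →
      Complex.exp (-(t : ℂ) * μ) * (C * ((z - τ) * Complex.exp (l z))) ∈
        (fun z => C * ((z - τ) * Complex.exp (l z))) '' openDisk := by
  have hτ1 : 0 < 1 - Complex.normSq τ := by linarith [normSq_lt_one_of_mem_openDisk hτ]
  have hτc : ((1 - Complex.normSq τ : ℝ) : ℂ) ≠ 0 := Complex.ofReal_ne_zero.2 hτ1.ne'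
  have hτe : ((1 - Complex.normSq τ : ℝ) : ℂ) = 1 - τ * conj τ := by
    rw [Complex.mul_conj]; push_cast; rfl
  -- The subtracted logarithm accounts for the denominator of diskMobius τ ζ - τ = ζ(1 - |τ|²)/(1 +
  -- τ̄ζ), so that τ is moved to 0.
  let k : ℂ → ℂ := fun ζ => l (diskMobius τ ζ) - Complex.log (1 + conj τ * ζ)
  let k' : ℂ → ℂ := fun ζ => l' (diskMobius τ ζ) * ((1 - τ * conj τ) / (1 + conj τ * ζ) ^ 2) -
    conj τ / (1 + conj τ * ζ)
  have hD : ∀ ζ : ℂ, HasDerivAt (fun ζ => 1 + conj τ * ζ) (conj τ) ζ := by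
    intro ζ
    simpa using ((hasDerivAt_id ζ).const_mul (conj τ)).const_add 1
  have hk : ∀ ζ ∈ openDisk, HasDerivAt k (k' ζ) ζ := by
    intro ζ hζ
    have h1 : HasDerivAt (diskMobius τ) ((1 - τ * conj τ) / (1 + conj τ * ζ) ^ 2) ζ := by
      refine (((hasDerivAt_id ζ).add_const τ).div (hD ζ)
        (one_add_conj_mul_ne_zero hτ hζ)).congr_deriv ?_
      simp only [id]
      congr 1; ring
    exact ((hl _ (mapsTo_diskMobius hτ hζ)).comp ζ h1).sub
      ((hD ζ).clog (one_add_conj_mul_mem_slitPlane hτ hζ))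
  have hkpos : ∀ ζ ∈ openDisk, 0 < ((1 + ζ * k' ζ) / μ).re := by
    intro ζ hζ
    have h1 := hpos _ (mapsTo_diskMobius hτ hζ)
    have hne := one_add_conj_mul_ne_zero hτ hζ
    rw [mul_comm (conj τ)] at hne
    have e : (1 - diskMobius τ ζ * conj τ) * (1 + (diskMobius τ ζ - τ) * l' (diskMobius τ ζ)) / μ =
        ((1 - Complex.normSq τ : ℝ) : ℂ) * ((1 + ζ * k' ζ) / μ) := by
      rw [hτe]
      simp only [k']
      generalize l' (diskMobius τ ζ) = x
      unfold diskMobius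
      rw [mul_div_assoc']
      congr 1
      field_simp
      ring
    rw [e, Complex.re_ofReal_mul] at h1
    exact pos_of_mul_pos_right h1 hτ1.le
  set g : ℂ → ℂ := fun z => C * ((z - τ) * Complex.exp (l z)) with hg
  set q : ℂ → ℂ := fun ζ => ζ * Complex.exp (k ζ) with hq
  have hgq : ∀ ζ ∈ openDisk, g (diskMobius τ ζ) = C * (1 - τ * conj τ) * q ζ := by
    intro ζ hζ
    have hne := one_add_conj_mul_ne_zero hτ hζ
    have e : diskMobius τ ζ - τ = ζ * (1 - τ * conj τ) / (1 + conj τ * ζ) := by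
      rw [mul_comm (conj τ)] at hne
      unfold diskMobius
      field_simp
      ring
    simp only [hg, hq, k]
    rw [Complex.exp_sub, Complex.exp_log hne, e]
    ring
  have hc : C * (1 - τ * conj τ) ≠ 0 := mul_ne_zero hC (hτe ▸ hτc)
  have hinv : ∀ z ∈ openDisk, ∃ ζ ∈ openDisk, diskMobius τ ζ = z := fun z hz =>
    ⟨diskMobius (-τ) z, mapsTo_diskMobius (neg_mem_openDisk hτ) hz,
      diskMobius_diskMobius_neg hτ hz⟩
  constructor
  · intro a ha b hb hab
    obtain ⟨a, ha', rfl⟩ := hinv a ha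
    obtain ⟨b, hb', rfl⟩ := hinv b hb
    have hab' : g (diskMobius τ a) = g (diskMobius τ b) := hab
    rw [hgq a ha', hgq b hb'] at hab'
    rw [injOn_id_mul_exp hk hkpos ha' hb' (mul_left_cancel₀ hc hab')]
  · intro z hz t ht
    obtain ⟨ζ, hζ, rfl⟩ := hinv z hz
    obtain ⟨ξ, hξ, hξe⟩ := exp_mul_mem_image_id_mul_exp hk hkpos hζ ht
    refine ⟨diskMobius τ ξ, mapsTo_diskMobius hτ hξ, ?_⟩
    change g (diskMobius τ ξ) = _ * g (diskMobius τ ζ)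
    rw [hgq ξ hξ, hgq ζ hζ]
    have hξe' : q ξ = Complex.exp (-(t : ℂ) * μ) * q ζ := hξe
    rw [hξe']; ring

/-! ### Hurwitz's theorem for injective functions. -/

/-- If injective holomorphic functions converge locally uniformly, then a value that the limit
takes in an isolated way at `z₀` is taken near `z₀` by the approximating functions. -/
lemma TendstoLocallyUniformlyOn.eventually_exists_eq {ι : Type*} {p : Filter ι} {G : ι → ℂ → ℂ}
    {h : ℂ → ℂ} {U : Set ℂ} (hU : IsOpen U) (hG : TendstoLocallyUniformlyOn G h p U)
    (hh : ContinuousOn h U)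
    (hGd : ∀ᶠ i in p, DifferentiableOn ℂ (G i) U ∧ InjOn (G i) U) {z₀ : ℂ} (hz₀ : z₀ ∈ U)
    (hne : ∀ᶠ z in 𝓝[≠] z₀, h z ≠ h z₀) {R : ℝ} (hR : 0 < R) :
    ∀ᶠ i in p, ∃ z ∈ U, dist z z₀ ≤ R ∧ G i z = h z₀ := by
  obtain ⟨ε, hε, hball⟩ := Metric.mem_nhds_iff.1
    (inter_mem (hU.mem_nhds hz₀) (eventually_nhdsWithin_iff.1 hne))
  set r := min R (ε / 2) with hrdef
  have hr : 0 < r := lt_min hR (by positivity)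
  have hsub : Metric.closedBall z₀ r ⊆ U := fun z hz =>
    (hball (Metric.mem_ball.2 ((Metric.mem_closedBall.1 hz).trans_lt
      ((min_le_right _ _).trans_lt (by linarith))))).1
  obtain ⟨w, hw, hmin⟩ := (isCompact_sphere z₀ r).exists_isMinOn
    (NormedSpace.sphere_nonempty.2 hr.le) (f := fun z => ‖h z - h z₀‖)
    (((hh.mono hsub).mono Metric.sphere_subset_closedBall).sub continuousOn_const).norm
  set m := ‖h w - h z₀‖ with hm
  have hm0 : 0 < m := by
    refine norm_pos_iff.2 (sub_ne_zero.2 ?_)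
    refine (hball (Metric.mem_ball.2 ?_)).2 (ne_of_mem_of_not_mem hw (by simp [hr.ne]))
    rw [Metric.mem_sphere.1 hw]
    exact (min_le_right _ _).trans_lt (by linarith)
  have hunif := (tendstoLocallyUniformlyOn_iff_tendstoUniformlyOn_of_compact
    (isCompact_closedBall z₀ r)).1 (hG.mono hsub)
  -- With errors below m/8, |G i - G i z₀| stays above 3m/4 ≥ m/2 on the sphere. The quantitative
  -- open mapping theorem then covers the ball of radius m/4 about G i z₀, which contains h z₀.
  filter_upwards [Metric.tendstoUniformlyOn_iff.1 hunif (m / 8) (by positivity), hGd]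
    with i hi hd
  have hz₀m : z₀ ∈ Metric.closedBall z₀ r := Metric.mem_closedBall_self hr.le
  have hfreq : ∃ᶠ z in 𝓝 z₀, G i z ≠ G i z₀ := by
    have h1 : ∀ᶠ z in 𝓝[≠] z₀, G i z ≠ G i z₀ := by
      filter_upwards [self_mem_nhdsWithin, mem_nhdsWithin_of_mem_nhds (hU.mem_nhds hz₀)]
        with z hz hzU heq
      exact hz (hd.2 hzU hz₀ heq)
    exact h1.frequently.filter_mono nhdsWithin_le_nhds
  have hsphere : ∀ z ∈ Metric.sphere z₀ r, m / 2 ≤ ‖G i z - G i z₀‖ := by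
    intro z hz
    have h1 := hi z (Metric.sphere_subset_closedBall hz)
    have h2 := hi z₀ hz₀m
    have h3 : m ≤ ‖h z - h z₀‖ := hmin hz
    rw [dist_eq_norm] at h1 h2
    have h4 : h z - h z₀ = (h z - G i z) + (G i z - G i z₀) - (h z₀ - G i z₀) := by ring
    have h5 := norm_sub_le ((h z - G i z) + (G i z - G i z₀)) (h z₀ - G i z₀)
    have h6 := norm_add_le (h z - G i z) (G i z - G i z₀)
    rw [← h4] at h5
    linarith
  have hcl : DiffContOnCl ℂ (G i) (Metric.ball z₀ r) := hd.1.diffContOnCl_ball hsub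
  obtain ⟨z, hz, hze⟩ := hcl.ball_subset_image_closedBall hr hsphere hfreq
    (show h z₀ ∈ Metric.ball (G i z₀) (m / 2 / 2) from
      Metric.mem_ball.2 ((hi z₀ hz₀m).trans (by linarith)))
  exact ⟨z, hsub hz, (Metric.mem_closedBall.1 hz).trans (min_le_left _ _), hze⟩

/-- **Hurwitz's theorem**: a locally uniform limit of injective holomorphic functions is injective
if it is nowhere locally constant. -/
lemma TendstoLocallyUniformlyOn.injOn_of_injOn {ι : Type*} {p : Filter ι} [p.NeBot]
    {G : ι → ℂ → ℂ} {h : ℂ → ℂ} {U : Set ℂ} (hU : IsOpen U)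
    (hG : TendstoLocallyUniformlyOn G h p U) (hh : ContinuousOn h U)
    (hGd : ∀ᶠ i in p, DifferentiableOn ℂ (G i) U ∧ InjOn (G i) U)
    (hne : ∀ z₀ ∈ U, ∀ᶠ z in 𝓝[≠] z₀, h z ≠ h z₀) : InjOn h U := by
  intro a ha b hb hab
  by_contra hab'
  have hd : 0 < dist a b := dist_pos.2 hab'
  -- Radius `dist a b / 3` keeps the disks about `a` and `b` disjoint, so a common value would be
  -- taken twice by one injective `G i`.
  have h1 := hG.eventually_exists_eq hU hh hGd ha (hne a ha) (R := dist a b / 3) (by positivity)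
  have h2 := hG.eventually_exists_eq hU hh hGd hb (hne b hb) (R := dist a b / 3) (by positivity)
  obtain ⟨i, ⟨⟨x, hxU, hx, hxe⟩, ⟨y, hyU, hy, hye⟩⟩, hi⟩ := ((h1.and h2).and hGd).exists
  have hxy : x = y := hi.2 hxU hyU (by rw [hxe, hye, hab])
  rw [← hxy] at hy
  have := dist_triangle_left a b x
  linarith

/-! ### The logarithm of h and the perturbed functions. -/

lemma exists_isLogBranch {g h : ℂ → ℂ} (hg : DifferentiableOn ℂ g openDisk)
    (hh : ∀ z ∈ openDisk, HasDerivAt h (g z * h z) z) (h0 : h 0 = 1) : ∃ L, IsLogBranch h L := by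
  obtain ⟨L, hL0, hL⟩ := (hg.isExactOn_ball).with_val_at 0 0
  refine ⟨L, fun z hz => (hL z hz).differentiableAt.differentiableWithinAt, hL0, fun z hz => ?_⟩
  have hd : ∀ x ∈ openDisk, HasDerivAt (fun x => h x * Complex.exp (-L x)) 0 x := by
    intro x hx
    refine ((hh x hx).mul (hL x hx).neg.cexp).congr_deriv ?_
    ring
  have hconst := isOpen_openDisk.is_const_of_deriv_eq_zero
    (convex_ball (0 : ℂ) 1).isPreconnected
    (fun x hx => (hd x hx).differentiableAt.differentiableWithinAt)
    (fun x hx => (hd x hx).deriv) hz (show (0 : ℂ) ∈ openDisk by simp)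
  simp only [h0, hL0, neg_zero, Complex.exp_zero, mul_one, Complex.exp_neg] at hconst
  exact ((mul_inv_eq_one₀ (Complex.exp_ne_zero _)).1 hconst).symm

lemma IsLogBranch.hasDerivAt {h L : ℂ → ℂ} (hL : IsLogBranch h L) {g z : ℂ} (hz : z ∈ openDisk)
    (hh : HasDerivAt h (g * h z) z) : HasDerivAt L g z := by
  have h1 := (hL.differentiableOn.differentiableAt (openDisk_mem_nhds hz)).hasDerivAt
  have h2 : HasDerivAt h (Complex.exp (L z) * deriv L z) z := by
    refine h1.cexp.congr_of_eventuallyEq ?_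
    filter_upwards [openDisk_mem_nhds hz] with x hx using (hL.exp_eq x hx).symm
  have h3 := hh.unique h2
  rw [← hL.exp_eq z hz, mul_comm] at h3
  rwa [mul_left_cancel₀ (Complex.exp_ne_zero _) h3]

lemma one_sub_mem_slitPlane {z : ℂ} (hz : z ∈ openDisk) : 1 - z ∈ Complex.slitPlane := by
  have := Complex.mem_slitPlane_of_norm_lt_one (z := -z) (by simpa using mem_openDisk.1 hz)
  rwa [← sub_eq_add_neg] at this

/-- The logarithm of the nonvanishing factor of `perturbed`. -/
noncomputable def perturbedLog (L : ℂ → ℂ) (l μ τ z : ℂ) : ℂ :=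
  μ / l * L z + Complex.log (1 - z * conj τ) * (μ / conj μ) -
    Complex.log (1 - z) * (1 + μ / conj μ)

lemma perturbed_eq {L : ℂ → ℂ} {l μ τ z : ℂ} (hz : z ∈ openDisk) (hτ : τ ∈ openDisk) :
    perturbed L l μ τ z = -1 * ((z - τ) * Complex.exp (perturbedLog L l μ τ z)) := by
  have h1 := Complex.slitPlane_ne_zero (one_sub_mul_conj_mem_slitPlane hz hτ)
  have h2 := one_sub_ne_zero_of_mem_openDisk hz
  rw [perturbed, perturbedLog, Complex.cpow_def_of_ne_zero h1, Complex.cpow_def_of_ne_zero h2,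
    Complex.exp_sub, Complex.exp_add, div_neg]
  ring

lemma hasDerivAt_perturbedLog {L : ℂ → ℂ} {l μ τ z L' : ℂ} (hz : z ∈ openDisk)
    (hτ : τ ∈ openDisk) (hL : HasDerivAt L L' z) :
    HasDerivAt (perturbedLog L l μ τ) (μ / l * L' - μ / conj μ * (conj τ / (1 - z * conj τ)) +
      (1 + μ / conj μ) / (1 - z)) z := by
  have h1 : HasDerivAt (fun z => 1 - z * conj τ) (-conj τ) z := by
    simpa using ((hasDerivAt_id z).mul_const (conj τ)).const_sub 1
  have h2 : HasDerivAt (fun z : ℂ => 1 - z) (-1) z := (hasDerivAt_id z).const_sub 1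
  refine (((hL.const_mul (μ / l)).add
    ((h1.clog (one_sub_mul_conj_mem_slitPlane hz hτ)).mul_const (μ / conj μ))).sub
    ((h2.clog (one_sub_mem_slitPlane hz)).mul_const (1 + μ / conj μ))).congr_deriv ?_
  ring

/-- The perturbed function is univalent and spirallike with respect to `τ`. -/
lemma perturbed_isUnivalent_and_mem {f h L : ℂ → ℂ} {β : ℝ} {l μ τ : ℂ} (hf : IsPosGenerator f 1 β)
    (hl : l ≠ 0) (hh : ∀ z ∈ openDisk, HasDerivAt h (l / f z * h z) z) (hL : IsLogBranch h L)
    (hμ : μ ∈ omegaPlus β) (hτ : τ ∈ openDisk) :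
    IsUnivalent (perturbed L l μ τ) ∧ perturbed L l μ τ ∈ spirallikeClass τ := by
  have hderiv := fun z hz => hasDerivAt_perturbedLog (l := l) (μ := μ) hz hτ
    (hL.hasDerivAt hz (hh z hz))
  have hcrit := spirallike_criterion (μ := μ) (C := -1) hτ (by simp) hderiv (by
    intro z hz
    have := perturbed_re_pos hf.pos hμ hz hτ (hf.ne_zero hz) (hf.julia_inequality hz)
    rwa [div_mul_div_cancel₀ hl])
  have heq : EqOn (perturbed L l μ τ)
      (fun z => -1 * ((z - τ) * Complex.exp (perturbedLog L l μ τ z))) openDisk :=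
    fun z hz => perturbed_eq hz hτ
  have huni : IsUnivalent (perturbed L l μ τ) := by
    refine ⟨DifferentiableOn.congr (fun z hz => ?_) heq, heq.injOn_iff.2 hcrit.1⟩
    have h1 := (hderiv z hz).differentiableAt
    have h2 : DifferentiableAt ℂ
        (fun z => -1 * ((z - τ) * Complex.exp (perturbedLog L l μ τ z))) z := by fun_prop
    exact h2.differentiableWithinAt
  refine ⟨huni, ⟨huni, μ, re_pos_of_mem_omegaPlus hf.pos hμ, fun z hz t ht => ?_⟩,
    Or.inl ⟨hτ, by simp [perturbed]⟩⟩
  rw [heq.image_eq, heq hz]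
  exact hcrit.2 z hz t ht

lemma perturbed_zero {h L : ℂ → ℂ} (hL : IsLogBranch h L) (l μ τ : ℂ) :
    perturbed L l μ τ 0 = τ := by
  simp [perturbed, hL.zero]

/-- The formula still makes sense at τ = 1, where the factor multiplying h is identically 1. It is
jointly continuous at (1, z) because 1 - z stays in the slit plane, and joint continuity yields
locally uniform convergence. -/
lemma perturbed_tendsto {h L : ℂ → ℂ} {l : ℂ} (hl : l ≠ 0) (hL : IsLogBranch h L)
    (hh : DifferentiableOn ℂ h openDisk) :
    TendstoLocallyUniformlyOn (fun τ => perturbed L l l τ) h (𝓝[openDisk] 1) openDisk := by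
  rw [isOpen_openDisk.tendstoLocallyUniformlyOn_iff_forall_tendsto]
  intro z hz
  have hz1 := one_sub_ne_zero_of_mem_openDisk hz
  have hLc : ContinuousAt L z :=
    (hL.differentiableOn.differentiableAt (openDisk_mem_nhds hz)).continuousAt
  have hhc : ContinuousAt h z := (hh.differentiableAt (openDisk_mem_nhds hz)).continuousAt
  have hsnd : Tendsto (fun q : ℂ × ℂ => q.2) (𝓝 (1, z)) (𝓝 z) := continuous_snd.tendsto _
  have hfst : Tendsto (fun q : ℂ × ℂ => q.1) (𝓝 (1, z)) (𝓝 1) := continuous_fst.tendsto _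
  have hval : perturbed L l l 1 z = h z := by
    rw [perturbed, div_self hl, one_mul, hL.exp_eq z hz, map_one, mul_one,
      Complex.cpow_add _ _ hz1, Complex.cpow_one]
    have : (1 - z) ^ (l / conj l) ≠ 0 := by simp [Complex.cpow_eq_zero_iff, hz1]
    have hz2 : z - 1 = -(1 - z) := by ring
    rw [hz2]
    field_simp
  have hcont : Tendsto (fun q : ℂ × ℂ => perturbed L l l q.1 q.2) (𝓝 (1, z)) (𝓝 (h z)) := by
    rw [← hval]
    have hden : Tendsto (fun q : ℂ × ℂ => -(1 - q.2) ^ (1 + l / conj l)) (𝓝 (1, z))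
        (𝓝 (-(1 - z) ^ (1 + l / conj l))) :=
      ((tendsto_const_nhds.sub hsnd).cpow tendsto_const_nhds (one_sub_mem_slitPlane hz)).neg
    have hnum : Tendsto (fun q : ℂ × ℂ => (1 - q.2 * conj q.1) ^ (l / conj l)) (𝓝 (1, z))
        (𝓝 ((1 - z * conj 1) ^ (l / conj l))) := by
      refine (tendsto_const_nhds.sub
        (hsnd.mul ((Complex.continuous_conj.tendsto 1).comp hfst))).cpow tendsto_const_nhds ?_
      simpa using one_sub_mem_slitPlane hz
    have hexp : Tendsto (fun q : ℂ × ℂ => Complex.exp (l / l * L q.2)) (𝓝 (1, z))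
        (𝓝 (Complex.exp (l / l * L z))) :=
      (Complex.continuous_exp.tendsto _).comp
        (tendsto_const_nhds.mul (hLc.tendsto.comp hsnd))
    refine hexp.mul (((hsnd.sub hfst).mul hnum).div hden ?_)
    simp [Complex.cpow_eq_zero_iff, hz1]
  have hpair := ((hhc.tendsto.comp hsnd).prodMk_nhds hcont).mono_right
    (nhds_le_uniformity (h z))
  refine hpair.mono_left ?_
  rw [nhds_prod_eq]
  exact prod_mono_left _ nhdsWithin_le_nhds

/-! ### Linearization of the semigroup and the main theorem. -/

/-- A solution of the Koenigs-type equation linearizes the semigroup. -/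
lemma koenigs_semigroup {F : ℝ → ℂ → ℂ} {f h : ℂ → ℂ} {l : ℂ} (hF : IsHolSemigroup F)
    (hlim : ∀ z ∈ openDisk, Tendsto (fun t : ℝ => (z - F t z) / (t : ℂ)) (𝓝[>] 0) (𝓝 (f z)))
    (hh : DifferentiableOn ℂ h openDisk) (hode : ∀ z ∈ openDisk, l * h z = deriv h z * f z)
    {z : ℂ} (hz : z ∈ openDisk) {t : ℝ} (ht : 0 ≤ t) :
    h (F t z) = Complex.exp (-(t : ℂ) * l) * h z := by
  have hE : ∀ s : ℝ, HasDerivAt (fun s : ℝ => Complex.exp ((s : ℂ) * l))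
      (Complex.exp ((s : ℂ) * l) * l) s := by
    intro s
    have : HasDerivAt (fun s : ℝ => (s : ℂ) * l) l s := by
      simpa using (Complex.ofRealCLM.hasDerivAt (x := s)).mul_const l
    exact this.cexp
  have hhF : ∀ s, 0 ≤ s → HasDerivAt h (deriv h (F s z)) (F s z) := fun s hs =>
    (hh.differentiableAt (openDisk_mem_nhds (hF.mapsTo s hs hz))).hasDerivAt
  -- The orbit is only known to be differentiable from the right, which suffices for a continuous
  -- function with zero right derivative to be constant.
  have hconst := constant_of_has_deriv_right_zero (a := 0) (b := t)
    (f := fun s : ℝ => Complex.exp ((s : ℂ) * l) * h (F s z)) (by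
      refine ContinuousOn.mul (by fun_prop) ?_
      refine hh.continuousOn.comp ((hF.continuousOn z hz).mono Icc_subset_Ici_self) ?_
      exact fun s hs => hF.mapsTo s hs.1 hz) (by
      intro s hs
      have h1 := (hhF s hs.1).comp_hasDerivWithinAt s (hasDerivWithinAt_orbit hF hlim hz hs.1)
      refine ((hE s).hasDerivWithinAt.mul h1).congr_deriv ?_
      have := hode _ (hF.mapsTo s hs.1 hz)
      simp only [Function.comp_apply]
      linear_combination Complex.exp ((s : ℂ) * l) * this) t (right_mem_Icc.2 ht)
  simp only [Complex.ofReal_zero, zero_mul, Complex.exp_zero, one_mul, hF.zero z hz] at hconst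
  rw [← hconst, ← mul_assoc, ← Complex.exp_add]
  simp

lemma zero_mem_frontier_image {h : ℂ → ℂ} {l : ℂ} (hl : 0 < l.re)
    (hne : ∀ z ∈ openDisk, h z ≠ 0)
    (hspi : ∀ z ∈ openDisk, ∀ t : ℝ, 0 ≤ t → Complex.exp (-(t : ℂ) * l) * h z ∈ h '' openDisk) :
    (0 : ℂ) ∈ frontier (h '' openDisk) := by
  refine ⟨?_, fun hint => ?_⟩
  · have hlim : Tendsto (fun t : ℝ => Complex.exp (-(t : ℂ) * l) * h 0) atTop (𝓝 0) := by
      have : Tendsto (fun t : ℝ => Complex.exp (-(t : ℂ) * l)) atTop (𝓝 0) := by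
        rw [Complex.tendsto_exp_nhds_zero_iff]
        simpa using tendsto_id.atTop_mul_const hl
      simpa using this.mul_const (h 0)
    refine mem_closure_of_tendsto hlim ?_
    filter_upwards [eventually_ge_atTop 0] with t ht
    exact hspi 0 (by simp) t ht
  · obtain ⟨z, hz, hz0⟩ := interior_subset hint
    exact hne z hz hz0

theorem theorem3p5 (f h : ℂ → ℂ) (β : ℝ) (l : ℂ)
    (hf : IsPosGenerator f 1 β)
    (hl : l ∈ omegaPlus β)
    (hh : DifferentiableOn ℂ h openDisk)
    (hode : ∀ z ∈ openDisk, l * h z = deriv h z * f z)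
    (h0 : h 0 = 1)
    (h1 : HasAngularLimit h 1 0) :
    (∃ L, IsLogBranch h L) ∧
    (∀ L, IsLogBranch h L →
      (∀ μ ∈ omegaPlus β, ∀ τ ∈ openDisk,
        IsUnivalent (perturbed L l μ τ) ∧
        perturbed L l μ τ ∈ spirallikeClass τ ∧
        perturbed L l μ τ τ = 0 ∧
        perturbed L l μ τ 0 = τ) ∧
      TendstoLocallyUniformlyOn (fun τ => perturbed L l l τ) h (𝓝[openDisk] 1) openDisk) ∧
    IsUnivalent h ∧
    h ∈ spirallikeClass 1 ∧
    (l.im = 0 → h ∈ starlikeClass 1) := by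
  have hl0 : l ≠ 0 := hl.2
  have hlre := re_pos_of_mem_omegaPlus hf.pos hl
  have hderiv : ∀ z ∈ openDisk, HasDerivAt h (l / f z * h z) z := by
    intro z hz
    refine (hh.differentiableAt (openDisk_mem_nhds hz)).hasDerivAt.congr_deriv ?_
    have := hf.ne_zero hz
    field_simp
    rw [hode z hz]
  obtain ⟨L, hL⟩ := exists_isLogBranch
    ((differentiableOn_const l).div hf.isGenerator.1 fun z hz => hf.ne_zero hz) hderiv h0
  have hne : ∀ z ∈ openDisk, h z ≠ 0 := fun z hz => by
    rw [← hL.exp_eq z hz]; exact Complex.exp_ne_zero _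
  have hbot : (𝓝[openDisk] (1 : ℂ)).NeBot := by
    rw [← mem_closure_iff_nhdsWithin_neBot, closure_ball _ one_ne_zero]
    simp
  have huni : IsUnivalent h := by
    refine ⟨hh, (perturbed_tendsto hl0 hL hh).injOn_of_injOn isOpen_openDisk hh.continuousOn ?_
      fun z hz => ?_⟩
    · filter_upwards [self_mem_nhdsWithin] with τ hτ
      exact (perturbed_isUnivalent_and_mem hf hl0 hderiv hL hl hτ).1
    -- The derivative λh/f never vanishes, so h is nowhere locally constant.
    · exact (hderiv z hz).eventually_ne
        (mul_ne_zero (div_ne_zero hl0 (hf.ne_zero hz)) (hne z hz))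
  have hspi : ∀ z ∈ openDisk, ∀ t : ℝ, 0 ≤ t →
      Complex.exp (-(t : ℂ) * l) * h z ∈ h '' openDisk := by
    obtain ⟨-, F, hF, hlim⟩ := hf.isGenerator
    exact fun z hz t ht => ⟨F t z, hF.mapsTo t ht hz, koenigs_semigroup hF hlim hh hode hz ht⟩
  have hvan : VanishesAt h 1 := Or.inr ⟨norm_one, h1, zero_mem_frontier_image hlre hne hspi⟩
  refine ⟨⟨L, hL⟩, fun L hL => ⟨fun μ hμ τ hτ => ?_, perturbed_tendsto hl0 hL hh⟩, huni,
    ⟨⟨huni, l, hlre, hspi⟩, hvan⟩, fun him => ⟨⟨huni, fun z hz t ht ht1 => ?_⟩, hvan⟩⟩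
  · have := perturbed_isUnivalent_and_mem hf hl0 hderiv hL hμ hτ
    exact ⟨this.1, this.2, by simp [perturbed], perturbed_zero hL l μ τ⟩
  · have hlr : l = (l.re : ℂ) := Complex.ext (by simp) (by simp [him])
    -- For real λ the spirals are radial segments; the time s = -log t / λ solves e^{-sλ} = t.
    have hs := hspi z hz (-Real.log t / l.re)
      (div_nonneg (neg_nonneg.2 (Real.log_nonpos ht.le ht1)) hlre.le)
    have e : Complex.exp (-((-Real.log t / l.re : ℝ) : ℂ) * l) = (t : ℂ) := by
      rw [hlr, ← Complex.ofReal_neg, ← Complex.ofReal_mul, ← Complex.ofReal_exp]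
      rw [Complex.ofReal_re, neg_div, neg_neg, div_mul_cancel₀ _ hlre.ne', Real.exp_log ht]
    rwa [e] at hs
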